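/- Let $l\ge 2$, let $\mathbb F_q\subset\mathbb F_{q^2}$ be finite fields, write $\bar x=x^q$ for $x\in\mathbb F_{q^2}$, and let $\bar X$ be the matrix obtained from $X$ by applying the bar to all entries. Index the rows and columns of $2l\times 2l$ matrices by $1,\dots,l,-1,\dots,-l$ and those of $(2l+1)\times(2l+1)$ matrices by $0,1,\dots,l,-1,\dots,-l$. Put $$\beta=\begin{pmatrix}0&I_l\\ I_l&0\end{pmatrix}\ (d=2l),\qquad \beta=\begin{pmatrix}2&0&0\\0&0&I_l\\0&I_l&0\end{pmatrix}\ (d=2l+1),$$ $\mathrm U(d,q^2)=\{X\in \mathrm{GL}(d,\mathbb F_{q^2}) : {}^T\!\bar X\beta X=\beta\}$ and $\mathrm{SU}(d,q^2)=\{X\in\mathrm U(d,q^2):\det X=1\}$; $q$ is arbitrary if $d=2l$ and odd if $d=2l+1$. Let $e_{i,j}$ be the matrix units. The elementary matrices are, for $1\le i,j\le l$, $t,s\in\mathbb F_{q^2}$ with $\bar s=-s$, $$x_{i,j}(t)=I+te_{i,j}-\bar te_{-j,-i}\ (i\ne j),\quad x_{i,-j}(t)=I+te_{i,-j}-\bar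 te_{j,-i}\ (i<j),\quad x_{-i,j}(t)=I+te_{-i,j}-\bar te_{-j,i}\ (i<j),$$ $$x_{i,-i}(s)=I+se_{i,-i},\qquad x_{-i,i}(s)=I+se_{-i,i},$$ and, only when $d=2l+1$, also $$x_{i,0}(t)=I-2\bar te_{i,0}+te_{0,-i}-t\bar te_{i,-i},\qquad x_{0,i}(t)=I+te_{0,i}-2\bar te_{-i,0}-t\bar te_{-i,i}.$$ For $s\neq0$ with $\bar s=-s$ put $w_{i,-i}(s)=x_{i,-i}(s)\,x_{-i,i}(-s^{-1})\,x_{i,-i}(s)$. (1) $\mathrm{SU}(2l,q^2)$ is exactly the set of finite products of elementary matrices. (2) Let $\lambda\in\mathbb F_{q^2}^\times$. The matrix $\mathrm{diag}(1,\dots,1,\lambda,1,\dots,1,\bar\lambda^{-1})$, with $\lambda$ at position $l$ and $\bar\lambda^{-1}$ at position $-l$, lies in $\mathrm{SU}(2l,q^2)$ if and only if $\lambda\in\mathbb F_q$. If $\lambda\in\mathbb F_q^\times$, then for every non-zero $\varepsilon\in\mathbb F_{q^2}$ with $\bar\varepsilon=-\varepsilon$ $$w_{l,-l}(\varepsilon\lambda)\,w_{l,-l}(-\varepsilon)=\mathrm{diag}(1,\dots,1,\lambda,1,\dots,1,\lambda^{-1}),$$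 and both factors are products of elementary matrices. (3) Let $q$ be odd, let $\zeta_1$ be a generator of the group $\{x\in\mathbb F_{q^2}^\times : x\bar x=1\}$, and let $h(\zeta_1)=\mathrm{diag}(\zeta_1,1,\dots,1)$, with $\zeta_1$ at position $0$. Then $h(\zeta_1)\in\mathrm U(2l+1,q^2)$, the elementary matrices lie in $\mathrm{SU}(2l+1,q^2)$, and $\mathrm{SU}(2l+1,q^2)$ is exactly the set of those finite products of elementary matrices and copies of $h(\zeta_1)$ that have determinant $1$. In particular every element of $\mathrm{SU}(2l+1,q^2)$ is a product of elementary matrices and copies of $h(\zeta_1)$. -/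

import Mathlib

open Matrix

/-- The conjugation `x ↦ x̄ = x ^ q` of a finite extension `K` of the finite field `k` with `q`
elements.  When `[K : k] = 2` this is the automorphism of order two of `F_{q²}` over `F_q`. -/
noncomputable def conjFq (k K : Type*) [Field k] [Fintype k] [Field K] [Algebra k K] : K →+* K :=
  (FiniteField.frobeniusAlgHom k K : K →ₐ[k] K)

theorem conjFq_apply (k K : Type*) [Field k] [Fintype k] [Field K] [Algebra k K] (x : K) :
    conjFq k K x = x ^ Fintype.card k := rfl

/-- The unitary group `{X ∈ GL | ᵗX̄ β X = β}` of the form with matrix `β`, where the bar is the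
entrywise application of `σ`. -/
def unitaryGp {n K : Type*} [Fintype n] [DecidableEq n] [Field K] (σ : K →+* K)
    (β : Matrix n n K) : Subgroup (GL n K) where
  carrier := {X | ((X : Matrix n n K).map σ)ᵀ * β * (X : Matrix n n K) = β}
  one_mem' := by simp
  mul_mem' := by
    intro X Y hX hY
    simp only [Set.mem_ofPred_eq, Units.val_mul, Matrix.map_mul, Matrix.transpose_mul] at *
    calc _ = ((Y : Matrix n n K).map σ)ᵀ * (((X : Matrix n n K).map σ)ᵀ * β * (X : Matrix n n K))
            * (Y : Matrix n n K) := by simp only [Matrix.mul_assoc]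
      _ = β := by rw [hX, hY]
  inv_mem' := by
    intro X hX
    simp only [Set.mem_ofPred_eq] at *
    have h1 : (X : Matrix n n K) * ((X⁻¹ : GL n K) : Matrix n n K) = 1 := Units.mul_inv X
    have h2 : (((X⁻¹ : GL n K) : Matrix n n K).map σ)ᵀ * ((X : Matrix n n K).map σ)ᵀ = 1 := by
      rw [← Matrix.transpose_mul, ← Matrix.map_mul, h1]
      simp
    calc _ = (((X⁻¹ : GL n K) : Matrix n n K).map σ)ᵀ *
            (((X : Matrix n n K).map σ)ᵀ * β * (X : Matrix n n K)) *
            ((X⁻¹ : GL n K) : Matrix n n K) := by rw [hX]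
      _ = ((((X⁻¹ : GL n K) : Matrix n n K).map σ)ᵀ * ((X : Matrix n n K).map σ)ᵀ) * β *
            ((X : Matrix n n K) * ((X⁻¹ : GL n K) : Matrix n n K)) := by
          simp only [Matrix.mul_assoc]
      _ = β := by rw [h1, h2]; simp

/-- The special unitary group: the elements of determinant `1` of the unitary group. -/
def specialUnitaryGp {n K : Type*} [Fintype n] [DecidableEq n] [Field K] (σ : K →+* K)
    (β : Matrix n n K) : Subgroup (GL n K) :=
  unitaryGp σ β ⊓ (Matrix.GeneralLinearGroup.det (n := n) (R := K)).ker

/-- Index set `1, …, l, -1, …, -l` of the basis in dimension `2l`. -/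
abbrev EvenIdx (l : ℕ) : Type := Fin l ⊕ Fin l

/-- Index set `0, 1, …, l, -1, …, -l` of the basis in dimension `2l + 1`. -/
abbrev OddIdx (l : ℕ) : Type := Unit ⊕ (Fin l ⊕ Fin l)

namespace EvenIdx

/-- The index `i`. -/
abbrev pos {l : ℕ} (i : Fin l) : EvenIdx l := Sum.inl i

/-- The index `-i`. -/
abbrev neg {l : ℕ} (i : Fin l) : EvenIdx l := Sum.inr i

end EvenIdx

namespace OddIdx

/-- The index `0`. -/
abbrev zero {l : ℕ} : OddIdx l := Sum.inl ()

/-- The index `i`. -/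
abbrev pos {l : ℕ} (i : Fin l) : OddIdx l := Sum.inr (Sum.inl i)

/-- The index `-i`. -/
abbrev neg {l : ℕ} (i : Fin l) : OddIdx l := Sum.inr (Sum.inr i)

end OddIdx

/-- The Hermitian form with blocks `0, I; I, 0` in dimension `2l`. -/
def evenForm (K : Type*) [Field K] (l : ℕ) : Matrix (EvenIdx l) (EvenIdx l) K :=
  Matrix.fromBlocks 0 1 1 0

/-- The Hermitian form `2 ⊕ (0, I; I, 0)` in dimension `2l + 1`. -/
def oddForm (K : Type*) [Field K] (l : ℕ) : Matrix (OddIdx l) (OddIdx l) K :=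
  Matrix.fromBlocks (Matrix.diagonal fun _ => 2) 0 0 (evenForm K l)

/-- `SU(2l, q²)` for `K = F_{q²}` over `k = F_q`. -/
noncomputable def SUEven (k K : Type*) [Field k] [Fintype k] [Field K] [Algebra k K] (l : ℕ) :
    Subgroup (GL (EvenIdx l) K) :=
  specialUnitaryGp (conjFq k K) (evenForm K l)

/-- `SU(2l + 1, q²)` for `K = F_{q²}` over `k = F_q`. -/
noncomputable def SUOdd (k K : Type*) [Field k] [Fintype k] [Field K] [Algebra k K] (l : ℕ) :
    Subgroup (GL (OddIdx l) K) :=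
  specialUnitaryGp (conjFq k K) (oddForm K l)

namespace EvenIdx

/-- `x_{i,-i}(s) = I + s e_{i,-i}`. -/
def xPosNeg {K : Type*} [Field K] {l : ℕ} (i : Fin l) (s : K) :
    Matrix (EvenIdx l) (EvenIdx l) K :=
  1 + Matrix.single (pos i) (neg i) s

/-- `x_{-i,i}(s) = I + s e_{-i,i}`. -/
def xNegPos {K : Type*} [Field K] {l : ℕ} (i : Fin l) (s : K) :
    Matrix (EvenIdx l) (EvenIdx l) K :=
  1 + Matrix.single (neg i) (pos i) s

/-- The row-interchange matrix `w_{i,-i}(s) = x_{i,-i}(s) x_{-i,i}(-s⁻¹) x_{i,-i}(s)`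
(meant for `s ≠ 0` with `s̄ = -s`). -/
def w {K : Type*} [Field K] {l : ℕ} (i : Fin l) (s : K) : Matrix (EvenIdx l) (EvenIdx l) K :=
  xPosNeg i s * xNegPos i (-s⁻¹) * xPosNeg i s

/-- `diag(1, …, 1, a, 1, …, 1, b)` with `a` at position `i` and `b` at position `-i`. -/
def diagAt {K : Type*} [Field K] {l : ℕ} (i : Fin l) (a b : K) :
    Matrix (EvenIdx l) (EvenIdx l) K :=
  Matrix.diagonal (Sum.elim (Function.update 1 i a) (Function.update 1 i b))

/-- The elementary matrices for `U(2l, K)`. -/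
inductive IsElementary {K : Type*} [Field K] (σ : K →+* K) {l : ℕ} :
    Matrix (EvenIdx l) (EvenIdx l) K → Prop
  | pos_pos (i j : Fin l) (hij : i ≠ j) (t : K) :
      IsElementary σ (1 + single (pos i) (pos j) t - single (neg j) (neg i) (σ t))
  | pos_neg (i j : Fin l) (hij : i < j) (t : K) :
      IsElementary σ (1 + single (pos i) (neg j) t - single (pos j) (neg i) (σ t))
  | neg_pos (i j : Fin l) (hij : i < j) (t : K) :
      IsElementary σ (1 + single (neg i) (pos j) t - single (neg j) (pos i) (σ t))
  | pos_neg_self (i : Fin l) (s : K) (hs : σ s = -s) : IsElementary σ (xPosNeg i s)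
  | neg_pos_self (i : Fin l) (s : K) (hs : σ s = -s) : IsElementary σ (xNegPos i s)

end EvenIdx

namespace OddIdx

/-- The elementary matrices for `U(2l + 1, K)`. -/
inductive IsElementary {K : Type*} [Field K] (σ : K →+* K) {l : ℕ} :
    Matrix (OddIdx l) (OddIdx l) K → Prop
  | pos_pos (i j : Fin l) (hij : i ≠ j) (t : K) :
      IsElementary σ (1 + single (pos i) (pos j) t - single (neg j) (neg i) (σ t))
  | pos_neg (i j : Fin l) (hij : i < j) (t : K) :
      IsElementary σ (1 + single (pos i) (neg j) t - single (pos j) (neg i) (σ t))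
  | neg_pos (i j : Fin l) (hij : i < j) (t : K) :
      IsElementary σ (1 + single (neg i) (pos j) t - single (neg j) (pos i) (σ t))
  | pos_neg_self (i : Fin l) (s : K) (hs : σ s = -s) :
      IsElementary σ (1 + single (pos i) (neg i) s)
  | neg_pos_self (i : Fin l) (s : K) (hs : σ s = -s) :
      IsElementary σ (1 + single (neg i) (pos i) s)
  | pos_zero (i : Fin l) (t : K) :
      IsElementary σ (1 - single (pos i) zero (2 * σ t) + single zero (neg i) t
        - single (pos i) (neg i) (t * σ t))
  | zero_pos (i : Fin l) (t : K) :
      IsElementary σ (1 + single zero (pos i) t - single (neg i) zero (2 * σ t)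
        - single (neg i) (pos i) (t * σ t))

/-- `h(z) = diag(z, 1, …, 1)`, with `z` at position `0`. -/
def h {K : Type*} [Field K] (l : ℕ) (z : K) : Matrix (OddIdx l) (OddIdx l) K :=
  Matrix.diagonal (Sum.elim (fun _ => z) 1)

end OddIdx

/-- The last index `l` among `1, …, l`. -/
def lastIdx (l : ℕ) (hl : 2 ≤ l) : Fin l := ⟨l - 1, by omega⟩

/-- The set of matrices underlying a subgroup of the general linear group. -/
def matricesOf {n K : Type*} [Fintype n] [DecidableEq n] [Field K] (G : Subgroup (GL n K)) :
    Set (Matrix n n K) :=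
  (fun X : GL n K => (X : Matrix n n K)) '' (G : Set (GL n K))

/-- The set of all finite products (the empty product being `I`) of matrices from `S`. -/
def productsOf {n K : Type*} [Fintype n] [DecidableEq n] [Field K] (S : Set (Matrix n n K)) :
    Set (Matrix n n K) :=
  {M | ∃ L : List (Matrix n n K), (∀ X ∈ L, X ∈ S) ∧ L.prod = M}

/-! Both dimensions are treated by one Gaussian elimination on an isometry `M` of a monomial form,
given by an involution `ν` of the indices (`i ↦ -i`, fixing `0`) and coefficients `c`. If the column
of `α` has a non-zero entry at `α`, shears out of the coordinate `α` kill every other entry except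
the one at `ν α`. The column is isotropic, so that last entry divided by the pivot is skew, and a
single long transvection removes it. Pairing with the cleared column puts `(σ a)⁻¹` at position `ν
α` of the opposite column, where `a` is the pivot, and that column is cleared in the same way
(`exists_normalize_pair`).

While a second pair of indices is available the pivot can be made `1`, so pairs become trivial one
by one. `exists_reduce` leaves a single pair with entries `a` and `(σ a)⁻¹`.

In even dimension, determinant one forces `σ a = a`, and the remaining diagonal matrix is a product
of two matrices `w`. In odd dimension, a detour through the coordinate `0` replaces `a` by `1`,
because every element of `F_q` is a norm (`exists_rescale`). What remains is `h d` with `d * σ d =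
1`, a power of `h ζ₁`. Since the groups are finite, inverses are powers and monoids generated by the
matrices suffice. -/

section Conjugation

/-! ### Conjugation on a quadratic extension of finite fields. -/

variable {k K : Type*} [Field k] [Fintype k] [Field K] [Algebra k K]

theorem finite_of_finrank_eq_two (hK : Module.finrank k K = 2) : Finite K :=
  have : Module.Finite k K := Module.finite_of_finrank_pos (by omega)
  Module.finite_of_finite k

theorem conjFq_conjFq (hK : Module.finrank k K = 2) (x : K) :
    conjFq k K (conjFq k K x) = x := by
  have := finite_of_finrank_eq_two hK
  have := Fintype.ofFinite K
  rw [conjFq_apply, conjFq_apply, ← pow_mul, ← sq, ← hK, ← Module.card_eq_pow_finrank,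
    FiniteField.pow_card]

theorem conjFq_algebraMap (c : k) : conjFq k K (algebraMap k K c) = algebraMap k K c := by
  rw [conjFq_apply, ← map_pow, FiniteField.pow_card]

/-- The Galois group consists of powers of Frobenius, so being fixed by Frobenius means being fixed
by the whole group. -/
theorem conjFq_eq_self_iff (hK : Module.finrank k K = 2) {x : K} :
    conjFq k K x = x ↔ x ∈ Set.range (algebraMap k K) := by
  have := finite_of_finrank_eq_two hK
  refine ⟨fun h => ?_, fun ⟨c, hc⟩ => hc ▸ conjFq_algebraMap c⟩
  rw [IsGalois.mem_range_algebraMap_iff_fixed]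
  intro f
  obtain ⟨n, rfl⟩ := (FiniteField.bijective_frobeniusAlgEquivOfAlgebraic_pow k K).2 f
  have hfix : Function.IsFixedPt (FiniteField.frobeniusAlgEquivOfAlgebraic k K) x := h
  rw [AlgEquiv.coe_pow]
  exact hfix.iterate n

/-- Every `x - x̄` is skew. If all of them vanished, conjugation would be trivial and the extension
would have degree one. The argument works in every characteristic. -/
theorem exists_conjFq_eq_neg (hK : Module.finrank k K = 2) :
    ∃ ε : K, ε ≠ 0 ∧ conjFq k K ε = -ε := by
  by_contra! hne
  have hfix : ∀ x : K, x ∈ Set.range (algebraMap k K) := fun x => by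
    rw [← conjFq_eq_self_iff hK]
    by_contra hx
    refine hne (x - conjFq k K x) (sub_ne_zero.2 (Ne.symm hx)) ?_
    rw [map_sub, conjFq_conjFq hK, neg_sub]
  have htop : (⊥ : Subalgebra k K) = ⊤ := by
    rw [eq_top_iff]
    exact fun x _ => Algebra.mem_bot.2 (hfix x)
  have := Subalgebra.bot_eq_top_iff_finrank_eq_one.1 htop
  omega

/-- This is surjectivity of the norm of finite fields, which is the power map with exponent `(q² -
1) / (q - 1) = q + 1`. -/
theorem exists_mul_conjFq_eq (hK : Module.finrank k K = 2) {r : K} (hr : conjFq k K r = r) :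
    ∃ m : K, m * conjFq k K m = r := by
  have := finite_of_finrank_eq_two hK
  have := Fintype.ofFinite K
  obtain ⟨c, rfl⟩ := (conjFq_eq_self_iff hK).1 hr
  obtain ⟨m, rfl⟩ := FiniteField.norm_surjective k K c
  refine ⟨m, ?_⟩
  have hcard : Nat.card K = Fintype.card k ^ 2 := by
    rw [← hK, ← Module.card_eq_pow_finrank, Nat.card_eq_fintype_card]
  have hq : 1 < Fintype.card k := Fintype.one_lt_card
  have hdiv : (Nat.card K - 1) / (Nat.card k - 1) = Fintype.card k + 1 := by
    rw [hcard, Nat.card_eq_fintype_card]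
    apply Nat.div_eq_of_eq_mul_left (by omega)
    simpa using Nat.sq_sub_sq (Fintype.card k) 1
  rw [FiniteField.algebraMap_norm_eq_pow, hdiv, conjFq_apply, pow_succ, mul_comm]

end Conjugation

/-! ### Finite products, and membership in the unitary groups as matrix equations. -/

section MatrixMonoid

variable {n K : Type*} [Fintype n] [DecidableEq n] [Field K]

theorem productsOf_eq_closure (S : Set (Matrix n n K)) :
    productsOf S = (Submonoid.closure S : Set (Matrix n n K)) := by
  rw [Submonoid.closure_eq_image_prod]
  rfl

/-- An invertible matrix over a finite field has finite order, so its inverse is one of its powers.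
This lets the elimination be undone inside a monoid. -/
theorem mem_submonoid_of_mul_mem [Finite K] {E : Submonoid (Matrix n n K)} {g M : Matrix n n K}
    (hg : g ∈ E) (hunit : IsUnit g) (hgM : g * M ∈ E) : M ∈ E := by
  obtain ⟨u, rfl⟩ := hunit
  obtain ⟨m, hm, hpow⟩ := (isOfFinOrder_iff_pow_eq_one).1 (isOfFinOrder_of_finite u)
  have hM : M = (u : Matrix n n K) ^ (m - 1) * (u * M) := by
    rw [← mul_assoc, ← pow_succ, Nat.sub_add_cancel hm, ← Units.val_pow_eq_pow_val, hpow,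
      Units.val_one, one_mul]
  rw [hM]
  exact E.mul_mem (E.pow_mem hg _) hgM

theorem mem_matricesOf_unitaryGp {σ : K →+* K} {β M : Matrix n n K} :
    M ∈ matricesOf (unitaryGp σ β) ↔ IsUnit M.det ∧ (M.map σ)ᵀ * β * M = β := by
  constructor
  · rintro ⟨X, hX, rfl⟩
    exact ⟨(Matrix.isUnit_iff_isUnit_det _).1 X.isUnit, hX⟩
  · rintro ⟨hdet, hM⟩
    obtain ⟨X, rfl⟩ := (Matrix.isUnit_iff_isUnit_det _).2 hdet
    exact ⟨X, hM, rfl⟩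

theorem mem_matricesOf_specialUnitaryGp {σ : K →+* K} {β M : Matrix n n K} :
    M ∈ matricesOf (specialUnitaryGp σ β) ↔ M.det = 1 ∧ (M.map σ)ᵀ * β * M = β := by
  constructor
  · rintro ⟨X, hX, rfl⟩
    have hker := (MonoidHom.mem_ker (f := Matrix.GeneralLinearGroup.det)).1 hX.2
    refine ⟨?_, hX.1⟩
    simpa [Units.ext_iff] using hker
  · rintro ⟨hdet, hM⟩
    have hunit : IsUnit M.det := hdet ▸ isUnit_one
    obtain ⟨X, rfl⟩ := (Matrix.isUnit_iff_isUnit_det _).2 hunit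
    refine ⟨X, ⟨hM, ?_⟩, rfl⟩
    change X ∈ (Matrix.GeneralLinearGroup.det).ker
    rw [MonoidHom.mem_ker]
    ext
    simpa using hdet

end MatrixMonoid

/-! ### Sesquilinear forms with a monomial matrix. -/

section Sesquilinear

variable {n K : Type*} [Fintype n] [Field K]

/-- The matrices preserving the sesquilinear form with matrix `β`. -/
def IsIsometry (σ : K →+* K) (β M : Matrix n n K) : Prop := (M.map σ)ᵀ * β * M = β

theorem IsIsometry.mul {σ : K →+* K} {β M N : Matrix n n K} (hM : IsIsometry σ β M)
    (hN : IsIsometry σ β N) : IsIsometry σ β (M * N) := by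
  unfold IsIsometry at *
  calc ((M * N).map σ)ᵀ * β * (M * N) = (N.map σ)ᵀ * ((M.map σ)ᵀ * β * M) * N := by
        rw [Matrix.map_mul, Matrix.transpose_mul]; simp only [Matrix.mul_assoc]
    _ = β := by rw [hM, hN]

/-- The sesquilinear form of a monomial matrix. -/
def sesq (σ : K →+* K) (ν : n → n) (c : n → K) (v w : n → K) : K :=
  ∑ a, σ (v a) * (c a * w (ν a))

variable {σ : K →+* K} {ν : n → n} {c : n → K}

theorem sesq_add_left (u v w : n → K) :
    sesq σ ν c (u + v) w = sesq σ ν c u w + sesq σ ν c v w := by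
  simp [sesq, add_mul, Finset.sum_add_distrib]

variable [DecidableEq n]

/-- The monomial form whose only non-zero entries `c a` stand at the positions `(a, ν a)`. -/
def monomialForm (ν : n → n) (c : n → K) : Matrix n n K :=
  Matrix.of fun a b => if b = ν a then c a else 0

theorem IsIsometry.one (σ : K →+* K) (β : Matrix n n K) : IsIsometry σ β 1 := by
  simp [IsIsometry]

/-- The submonoid of matrices preserving the form with matrix `β`. -/
def isometrySubmonoid (σ : K →+* K) (β : Matrix n n K) : Submonoid (Matrix n n K) where
  carrier := {M | IsIsometry σ β M}
  one_mem' := IsIsometry.one σ β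
  mul_mem' := IsIsometry.mul

theorem monomialForm_mulVec (w : n → K) (a : n) :
    (monomialForm ν c *ᵥ w) a = c a * w (ν a) := by
  simp [monomialForm, mulVec, dotProduct, ite_mul]

theorem sesq_eq_dotProduct (v w : n → K) :
    sesq σ ν c v w = (σ ∘ v) ⬝ᵥ (monomialForm ν c *ᵥ w) := by
  simp [sesq, dotProduct, monomialForm_mulVec]

theorem IsIsometry.sesq_mulVec {M : Matrix n n K} (hM : IsIsometry σ (monomialForm ν c) M)
    (v w : n → K) : sesq σ ν c (M *ᵥ v) (M *ᵥ w) = sesq σ ν c v w := by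
  have hmap : (σ ∘ (M *ᵥ v)) = (M.map σ) *ᵥ (σ ∘ v) := by
    ext i
    simp [mulVec, dotProduct]
  rw [sesq_eq_dotProduct, sesq_eq_dotProduct, hmap, ← vecMul_transpose, ← dotProduct_mulVec,
    mulVec_mulVec, mulVec_mulVec, hM]

/-- The form is nondegenerate: a vector killed by `M` pairs to zero with every basis vector, and
these pairings read off its coordinates. -/
theorem IsIsometry.isUnit {M : Matrix n n K} (hν : Function.Involutive ν) (hc : ∀ a, c a ≠ 0)
    (hM : IsIsometry σ (monomialForm ν c) M) : IsUnit M := by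
  rw [Matrix.isUnit_iff_isUnit_det, isUnit_iff_ne_zero]
  intro hdet
  obtain ⟨v, hv, hMv⟩ := Matrix.exists_mulVec_eq_zero_iff.2 hdet
  apply hv
  ext a
  have h := hM.sesq_mulVec (Pi.single (ν a) 1) v
  rw [hMv] at h
  have hl : sesq σ ν c (M *ᵥ Pi.single (ν a) 1) 0 = 0 := by simp [sesq]
  have hr : sesq σ ν c (Pi.single (ν a) 1) v = c (ν a) * v a := by
    unfold sesq
    rw [Finset.sum_eq_single (ν a)] <;> simp +contextual [hν a]
  rw [hl, hr] at h
  simpa [hc] using h.symm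

theorem sesq_single_left (a : n) (x : K) (w : n → K) :
    sesq σ ν c (Pi.single a x) w = σ x * (c a * w (ν a)) := by
  unfold sesq
  rw [Finset.sum_eq_single a] <;> simp +contextual

theorem one_add_single_mulVec (a b : n) (s : K) (v : n → K) :
    (1 + single a b s) *ᵥ v = v + Pi.single a (s * v b) := by
  rw [add_mulVec, one_mulVec, single_mulVec_eq]
  ext i
  simp [Pi.single_apply]

end Sesquilinear

/-! ### Row reduction of isometries. -/

section Elimination

variable {n K : Type*} [Fintype n] [DecidableEq n] [Field K]

/-- A monoid `E` of isometries of a monomial form that contains enough shears for row reduction: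
`shear` adds a multiple of one coordinate to another one, at the cost of changing the coordinate
opposite to the first, and `long` is the transvection along a coordinate vector. -/
structure EliminationSystem (σ : K →+* K) (ν : n → n) (c : n → K)
    (E : Submonoid (Matrix n n K)) : Prop where
  conj_conj : ∀ x, σ (σ x) = x
  involutive : Function.Involutive ν
  coeff_moved : ∀ a, ν a ≠ a → c a = 1
  coeff_ne : ∀ a, c a ≠ 0
  fixed_unique : ∀ a b, ν a = a → ν b = b → a = b
  exists_skew : ∃ ε : K, ε ≠ 0 ∧ σ ε = -ε
  isometry : ∀ g ∈ E, IsIsometry σ (monomialForm ν c) g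
  shear : ∀ (α β : n) (t : K), ν α ≠ α → β ≠ α → β ≠ ν α → ∃ y ∈ E,
    (∀ v, (y *ᵥ v) β = v β + t * v α) ∧
    (∀ v γ, γ ≠ β → γ ≠ ν α → (y *ᵥ v) γ = v γ) ∧
    (∀ γ, γ ≠ α → γ ≠ ν β → y *ᵥ Pi.single γ 1 = Pi.single γ 1) ∧
    (t = 0 → y = 1)
  long : ∀ (α : n) (s : K), ν α ≠ α → σ s = -s → 1 + single α (ν α) s ∈ E

namespace EliminationSystem

variable {σ : K →+* K} {ν : n → n} {c : n → K} {E : Submonoid (Matrix n n K)}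

/-- One shear out of `α` is used for each coordinate in `A`; the damage goes to the coordinate `ν α`
only. The last clause protects columns normalized earlier: the shear into `β` moves only the basis
vectors at `α` and `ν β`, and it is the identity when `v β = 0`. -/
theorem exists_clear_on (H : EliminationSystem σ ν c E) {α : n} (hα : ν α ≠ α) (v : n → K)
    (hv : v α ≠ 0) (A : Finset n) (hA : ∀ β ∈ A, β ≠ α ∧ β ≠ ν α) :
    ∃ g ∈ E, (∀ β ∈ A, (g *ᵥ v) β = 0) ∧ (∀ β ∉ A, β ≠ ν α → (g *ᵥ v) β = v β) ∧
      ∀ γ, γ ≠ α → (v (ν γ) = 0 ∨ γ = ν α) → g *ᵥ Pi.single γ 1 = Pi.single γ 1 := by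
  induction A using Finset.induction_on with
  | empty => exact ⟨1, E.one_mem, by simp, by simp, fun γ _ _ => one_mulVec _⟩
  | insert β A hβ ih =>
    obtain ⟨g, hg, hzero, hsame, hfix⟩ := ih fun b hb => hA b (Finset.mem_insert_of_mem hb)
    obtain ⟨hβα, hβν⟩ := hA β (Finset.mem_insert_self β A)
    obtain ⟨y, hy, hyβ, hyγ, hyfix, hy1⟩ := H.shear α β (-v β / v α) hα hβα hβν
    have hαA : α ∉ A := fun h => (hA α (Finset.mem_insert_of_mem h)).1 rfl
    refine ⟨y * g, E.mul_mem hy hg, ?_, ?_, ?_⟩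
    · intro b hb
      rw [← mulVec_mulVec]
      by_cases hbβ : b = β
      · subst hbβ
        rw [hyβ, hsame b hβ hβν, hsame α hαA hα.symm]
        field_simp
        ring
      · rw [hyγ _ b hbβ (hA b hb).2]
        exact hzero b (Finset.mem_of_mem_insert_of_ne hb hbβ)
    · intro b hb hbν
      rw [Finset.mem_insert, not_or] at hb
      rw [← mulVec_mulVec, hyγ _ b hb.1 hbν, hsame b hb.2 hbν]
    · intro γ hγ hcond
      rw [← mulVec_mulVec, hfix γ hγ hcond]
      by_cases hγβ : γ = ν β
      · rcases hcond with h0 | h1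
        · rw [hγβ, H.involutive] at h0
          rw [hy1 (by simp [h0]), one_mulVec]
        · exact absurd (H.involutive.injective (hγβ.symm.trans h1)) hβα
      · exact hyfix γ hγ hγβ

theorem exists_clear (H : EliminationSystem σ ν c E) {α : n} (hα : ν α ≠ α) (v : n → K)
    (hv : v α ≠ 0) (hiso : sesq σ ν c v v = 0) :
    ∃ g ∈ E, g *ᵥ v = Pi.single α (v α) ∧
      ∀ γ, γ ≠ α → (v (ν γ) = 0 ∨ γ = ν α) → g *ᵥ Pi.single γ 1 = Pi.single γ 1 := by
  obtain ⟨g, hg, hzero, hsame, hfix⟩ := H.exists_clear_on hα v hv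
    ((Finset.univ.erase α).erase (ν α)) (by simp +contextual)
  set b := (g *ᵥ v) (ν α) with hb
  have hgv : g *ᵥ v = Pi.single α (v α) + Pi.single (ν α) b := by
    ext i
    by_cases hi : i = α
    · subst hi
      rw [hsame i (by simp) hα.symm]
      simp [hα.symm]
    · by_cases hi' : i = ν α
      · subst hi'
        simp [hα, hb]
      · rw [hzero i (by simp [hi, hi'])]
        simp [hi, hi']
  have hαν : ν (ν α) = α := H.involutive α
  have hνα : ν (ν α) ≠ ν α := fun h => hα (H.involutive.injective h)
  have hiso' : σ (v α) * b + σ b * v α = 0 := by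
    rw [← (H.isometry g hg).sesq_mulVec, hgv, sesq_add_left, sesq_single_left,
      sesq_single_left, H.coeff_moved _ hα, H.coeff_moved _ hνα, hαν] at hiso
    simpa [Pi.single_apply, hα, hα.symm] using hiso
  have hσ : σ (v α) ≠ 0 := by simpa using hv
  -- Isotropy of `v` is exactly skewness of this ratio, so the long transvection that kills the
  -- entry at `ν α` is available.
  have hs : σ (-b / v α) = -(-b / v α) := by
    rw [map_div₀, map_neg]
    field_simp
    linear_combination -hiso'
  have hlong := H.long (ν α) (-b / v α) hνα hs
  rw [hαν] at hlong
  refine ⟨_, E.mul_mem hlong hg, ?_, ?_⟩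
  · rw [← mulVec_mulVec, hgv, one_add_single_mulVec, add_assoc, ← Pi.single_add]
    have : b + -b / v α * (Pi.single α (v α) + Pi.single (ν α) b : n → K) α = 0 := by
      simp only [Pi.add_apply, Pi.single_eq_same, Pi.single_eq_of_ne hα.symm, add_zero]
      field_simp
      ring
    rw [this]
    simp
  · intro γ hγ hcond
    rw [← mulVec_mulVec, hfix γ hγ hcond, one_add_single_mulVec]
    simp [hγ.symm]

/-- A normalized column at `γ` determines the row of `M` at `ν γ`, by pairing the images of basis
vectors. This supplies the vanishing entries that let later clearing steps preserve earlier columns.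
-/
theorem mulVec_single_opposite (H : EliminationSystem σ ν c E) {M : Matrix n n K}
    (hM : IsIsometry σ (monomialForm ν c) M) {γ : n} {a : K}
    (hγ : M *ᵥ Pi.single γ 1 = Pi.single γ a) (δ : n) :
    σ a * (M *ᵥ Pi.single δ 1) (ν γ) = if δ = ν γ then 1 else 0 := by
  have h := hM.sesq_mulVec (Pi.single γ 1) (Pi.single δ 1)
  rw [hγ, sesq_single_left, sesq_single_left, map_one, one_mul, mul_left_comm] at h
  have h' := mul_left_cancel₀ (H.coeff_ne γ) h
  rw [h']
  simp [Pi.single_apply, eq_comm]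

theorem exists_normalize_pair (H : EliminationSystem σ ν c E) {M : Matrix n n K}
    (hM : IsIsometry σ (monomialForm ν c) M) {α : n} (hα : ν α ≠ α) {a : K}
    (ha : (M *ᵥ Pi.single α 1) α = a) (ha0 : a ≠ 0) :
    ∃ g ∈ E, (g * M) *ᵥ Pi.single α 1 = Pi.single α a ∧
      (g * M) *ᵥ Pi.single (ν α) 1 = Pi.single (ν α) (σ a)⁻¹ ∧
      ∀ γ, γ ≠ α → γ ≠ ν α → M *ᵥ Pi.single γ 1 = Pi.single γ 1 →
        (g * M) *ᵥ Pi.single γ 1 = Pi.single γ 1 := by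
  have hαν : ν (ν α) = α := H.involutive α
  have hνα : ν (ν α) ≠ ν α := fun h => hα (H.involutive.injective h)
  have hisotropic : ∀ {N : Matrix n n K}, IsIsometry σ (monomialForm ν c) N → ∀ γ, ν γ ≠ γ →
      sesq σ ν c (N *ᵥ Pi.single γ 1) (N *ᵥ Pi.single γ 1) = 0 := by
    intro N hN γ hγ
    rw [hN.sesq_mulVec, sesq_single_left]
    simp [hγ]
  have hσa : σ a ≠ 0 := by simpa using ha0
  obtain ⟨g, hg, hgα, hgfix⟩ := H.exists_clear hα (M *ᵥ Pi.single α 1) (ha ▸ ha0)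
    (hisotropic hM α hα)
  rw [ha, mulVec_mulVec] at hgα
  have hN := (H.isometry g hg).mul hM
  have hopp : ((g * M) *ᵥ Pi.single (ν α) 1) (ν α) = (σ a)⁻¹ := by
    have := H.mulVec_single_opposite hN hgα (ν α)
    rw [if_pos rfl] at this
    exact eq_inv_of_mul_eq_one_right this
  obtain ⟨g', hg', hgα', hgfix'⟩ := H.exists_clear hνα ((g * M) *ᵥ Pi.single (ν α) 1)
    (by rw [hopp]; exact inv_ne_zero hσa) (hisotropic hN _ hνα)
  rw [hopp, mulVec_mulVec, ← mul_assoc] at hgα'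
  have hfixM : ∀ γ, γ ≠ α → γ ≠ ν α → M *ᵥ Pi.single γ 1 = Pi.single γ 1 →
      (g * M) *ᵥ Pi.single γ 1 = Pi.single γ 1 := by
    intro γ hγ hγν hγM
    rw [← mulVec_mulVec, hγM]
    refine hgfix γ hγ (Or.inl ?_)
    have := H.mulVec_single_opposite hM hγM α
    rwa [map_one, one_mul, if_neg] at this
    rintro rfl
    exact hγν (H.involutive γ).symm
  refine ⟨g' * g, E.mul_mem hg' hg, ?_, hgα', ?_⟩
  -- Clearing the opposite column uses shears out of `ν α`, which fix the basis vector at `α`, so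
  -- the first column survives.
  · have hscale : (Pi.single α a : n → K) = a • Pi.single α 1 := by
      rw [← Pi.single_smul, smul_eq_mul, mul_one]
    rw [mul_assoc, ← mulVec_mulVec, hgα, hscale, mulVec_smul,
      hgfix' α hα.symm (Or.inr hαν.symm)]
  · intro γ hγ hγν hγM
    rw [mul_assoc, ← mulVec_mulVec, hfixM γ hγ hγν hγM]
    refine hgfix' γ hγν (Or.inl ?_)
    have := H.mulVec_single_opposite hN (hfixM γ hγ hγν hγM) (ν α)
    rwa [map_one, one_mul, if_neg] at this
    intro h
    exact hγ (H.involutive.injective h).symm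

theorem exists_pivot_of_ne_zero (H : EliminationSystem σ ν c E) {α β : n} (hβ : ν β ≠ β)
    (hβα : β ≠ α) (hβν : β ≠ ν α) {v : n → K} (hv : v β ≠ 0) :
    ∃ y ∈ E, (y *ᵥ v) α = 1 ∧
      ∀ γ, γ ≠ β → γ ≠ ν α → y *ᵥ Pi.single γ 1 = Pi.single γ 1 := by
  have hαβ : α ≠ ν β := fun h => hβν (by rw [h, H.involutive])
  obtain ⟨y, hy, hyα, -, hyfix, -⟩ := H.shear β α ((1 - v α) / v β) hβ hβα.symm hαβ
  refine ⟨y, hy, ?_, hyfix⟩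
  rw [hyα]
  field_simp
  ring

/-- An index `β` outside the pair of `α` allows the pivot to be set to exactly `1`, so that the
opposite diagonal entry is `1` as well. If the only known non-zero entry lies in the pair of `α`, it
is first copied to `β`. -/
theorem exists_pivot (H : EliminationSystem σ ν c E) {T : Finset n}
    (hT : ∀ γ ∈ T, ν γ ≠ γ) (hTν : ∀ γ ∈ T, ν γ ∈ T) {α β δ : n} (hαT : α ∈ T) (hβT : β ∈ T)
    (hδT : δ ∈ T) (hβα : β ≠ α) (hβν : β ≠ ν α) {v : n → K} (hv : v δ ≠ 0) :
    ∃ y ∈ E, (y *ᵥ v) α = 1 ∧ ∀ γ ∉ T, y *ᵥ Pi.single γ 1 = Pi.single γ 1 := by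
  have hne : ∀ {γ δ}, γ ∉ T → δ ∈ T → γ ≠ δ := fun hγ hδ h => hγ (h ▸ hδ)
  by_cases hβ0 : v β = 0
  · by_cases hδ : δ = α ∨ δ = ν α
    · have hβδ : β ≠ δ := by rcases hδ with rfl | rfl <;> assumption
      have hβδ' : β ≠ ν δ := by
        rcases hδ with rfl | rfl
        · exact hβν
        · rwa [H.involutive]
      obtain ⟨x, hx, hxβ, -, hxfix, -⟩ := H.shear δ β 1 (hT δ hδT) hβδ hβδ'
      obtain ⟨y, hy, hyα, hyfix⟩ := H.exists_pivot_of_ne_zero (hT β hβT) hβα hβν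
        (v := x *ᵥ v) (by rw [hxβ, hβ0, zero_add, one_mul]; exact hv)
      refine ⟨y * x, E.mul_mem hy hx, by rw [← mulVec_mulVec, hyα], fun γ hγ => ?_⟩
      rw [← mulVec_mulVec, hxfix γ (hne hγ hδT) (hne hγ (hTν β hβT)),
        hyfix γ (hne hγ hβT) (hne hγ (hTν α hαT))]
    · rw [not_or] at hδ
      obtain ⟨y, hy, hyα, hyfix⟩ := H.exists_pivot_of_ne_zero (hT δ hδT) hδ.1 hδ.2 hv
      exact ⟨y, hy, hyα, fun γ hγ => hyfix γ (hne hγ hδT) (hne hγ (hTν α hαT))⟩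
  · obtain ⟨y, hy, hyα, hyfix⟩ := H.exists_pivot_of_ne_zero (hT β hβT) hβα hβν hβ0
    exact ⟨y, hy, hyα, fun γ hγ => hyfix γ (hne hγ hβT) (hne hγ (hTν α hαT))⟩

theorem exists_apply_ne_zero (H : EliminationSystem σ ν c E) {M : Matrix n n K}
    (hM : IsIsometry σ (monomialForm ν c) M) {T : Finset n} (hT : ∀ γ ∈ T, ν γ ≠ γ)
    (hTν : ∀ γ ∈ T, ν γ ∈ T)
    (hfix : ∀ γ, ν γ ≠ γ → γ ∉ T → M *ᵥ Pi.single γ 1 = Pi.single γ 1) {α : n} (hα : α ∈ T) :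
    ∃ δ ∈ T, (M *ᵥ Pi.single α 1) δ ≠ 0 := by
  by_contra! hzero
  have hmoved : ∀ δ, ν δ ≠ δ → (M *ᵥ Pi.single α 1) δ = 0 := by
    intro δ hδ
    by_cases hδT : δ ∈ T
    · exact hzero δ hδT
    · have hνδT : ν δ ∉ T := fun h => hδT (H.involutive δ ▸ hTν _ h)
      have hνδ : ν (ν δ) ≠ ν δ := fun h => hδ (H.involutive.injective h)
      have := H.mulVec_single_opposite hM (hfix _ hνδ hνδT) α
      rw [H.involutive, map_one, one_mul, if_neg] at this
      · exact this
      · rintro rfl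
        exact hδT hα
  -- Only the fixed index could still support the column. There the form is anisotropic, while the
  -- column is isotropic.
  have hnull : M *ᵥ Pi.single α 1 = 0 := by
    ext z
    by_contra hz
    have hzfix : ν z = z := by
      by_contra h
      exact hz (hmoved z h)
    have hsupp : M *ᵥ Pi.single α 1 = Pi.single z ((M *ᵥ Pi.single α 1) z) := by
      ext i
      by_cases hi : i = z
      · rw [hi, Pi.single_eq_same]
      · rw [Pi.single_eq_of_ne hi]
        exact hmoved i fun h => hi (H.fixed_unique i z h hzfix)
    have hiso := hM.sesq_mulVec (Pi.single α 1) (Pi.single α 1)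
    rw [hsupp, sesq_single_left, sesq_single_left, hzfix, Pi.single_eq_same,
      Pi.single_eq_of_ne (hT α hα)] at hiso
    simp only [mul_zero, mul_eq_zero, H.coeff_ne, false_or, map_eq_zero, or_self] at hiso
    exact hz hiso
  have hpair := hM.sesq_mulVec (Pi.single α 1) (Pi.single (ν α) 1)
  rw [hnull, sesq_single_left] at hpair
  exact H.coeff_ne α (by simpa [sesq, eq_comm] using hpair)

/-- The induction is on the set `T` of moved indices whose columns are not yet normalized. It stops
when `T` is a single pair, because normalizing the pivot to `1` needs a second pair. -/
theorem exists_reduce (H : EliminationSystem σ ν c E) (T : Finset n) :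
    ∀ M : Matrix n n K, IsIsometry σ (monomialForm ν c) M → T.Nonempty →
    (∀ γ ∈ T, ν γ ≠ γ) → (∀ γ ∈ T, ν γ ∈ T) →
    (∀ γ, ν γ ≠ γ → γ ∉ T → M *ᵥ Pi.single γ 1 = Pi.single γ 1) →
    ∃ g ∈ E, ∃ α, ν α ≠ α ∧ ∃ a : K, a ≠ 0 ∧ (g * M) *ᵥ Pi.single α 1 = Pi.single α a ∧
      (g * M) *ᵥ Pi.single (ν α) 1 = Pi.single (ν α) (σ a)⁻¹ ∧
      ∀ γ, ν γ ≠ γ → γ ≠ α → γ ≠ ν α → (g * M) *ᵥ Pi.single γ 1 = Pi.single γ 1 := by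
  induction T using Finset.strongInduction with
  | H T ih =>
    intro M hM ⟨α, hα⟩ hT hTν hfix
    have hνα := hT α hα
    obtain ⟨δ, hδT, hδ⟩ := H.exists_apply_ne_zero hM hT hTν hfix hα
    by_cases hother : ∃ β ∈ T, β ≠ α ∧ β ≠ ν α
    · obtain ⟨β, hβT, hβα, hβν⟩ := hother
      obtain ⟨y, hy, hyα, hyfix⟩ := H.exists_pivot hT hTν hα hβT hδT hβα hβν hδ
      rw [mulVec_mulVec] at hyα
      obtain ⟨g, hg, hgα, hgνα, hgfix⟩ := H.exists_normalize_pair ((H.isometry y hy).mul hM)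
        hνα hyα one_ne_zero
      rw [← mul_assoc] at hgα hgνα hgfix
      have hN := (H.isometry _ (E.mul_mem hg hy)).mul hM
      have hsub : (T.erase α).erase (ν α) ⊂ T :=
        (Finset.erase_subset _ _).trans_ssubset (Finset.erase_ssubset hα)
      obtain ⟨g', hg', α', h1, a, h2, h3, h4, h5⟩ := ih _ hsub (g * y * M) hN
        ⟨β, by simp [hβα, hβν, hβT]⟩ (fun γ hγ => hT γ (hsub.1 hγ)) (by
          intro γ hγ
          simp only [Finset.mem_erase] at hγ ⊢
          refine ⟨fun h => hγ.2.1 (H.involutive.injective h), fun h => hγ.1 ?_, hTν γ hγ.2.2⟩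
          rw [← h, H.involutive]) (by
          intro γ hγ hγT
          by_cases h1 : γ = α
          · rw [h1, hgα]
          by_cases h2 : γ = ν α
          · rw [h2, hgνα, map_one, inv_one]
          have hγT' : γ ∉ T := by simpa [h1, h2] using hγT
          exact hgfix γ h1 h2 (by rw [← mulVec_mulVec, hfix γ hγ hγT', hyfix γ hγT']))
      refine ⟨g' * (g * y), E.mul_mem hg' (E.mul_mem hg hy), α', h1, a, h2, ?_, ?_, ?_⟩ <;>
        rw [mul_assoc] <;> assumption
    · push Not at hother
      have hpivot : ∃ y ∈ E, (y *ᵥ (M *ᵥ Pi.single α 1)) α ≠ 0 ∧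
          ∀ γ, γ ≠ α → γ ≠ ν α → y *ᵥ Pi.single γ 1 = Pi.single γ 1 := by
        by_cases h0 : (M *ᵥ Pi.single α 1) α = 0
        · obtain ⟨ε, hε, hεσ⟩ := H.exists_skew
          -- With a zero pivot the non-zero entry must sit at `ν α`, and a long transvection with a
          -- non-zero skew parameter carries it to `α`.
          have hδα : δ = ν α := hother δ hδT (fun h => hδ (h ▸ h0))
          refine ⟨_, H.long α ε hνα hεσ, ?_, fun γ _ hγν => ?_⟩
          · rw [one_add_single_mulVec, Pi.add_apply, h0, Pi.single_eq_same, zero_add, ← hδα]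
            exact mul_ne_zero hε hδ
          · rw [one_add_single_mulVec]
            simp [hγν.symm]
        · exact ⟨1, E.one_mem, by rwa [one_mulVec], fun γ _ _ => one_mulVec _⟩
      obtain ⟨y, hy, hyα, hyfix⟩ := hpivot
      rw [mulVec_mulVec] at hyα
      obtain ⟨g, hg, hgα, hgνα, hgfix⟩ := H.exists_normalize_pair ((H.isometry y hy).mul hM)
        hνα rfl hyα
      rw [← mul_assoc] at hgα hgνα hgfix
      refine ⟨g * y, E.mul_mem hg hy, α, hνα, _, hyα, hgα, hgνα, fun γ hγ h1 h2 => ?_⟩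
      refine hgfix γ h1 h2 ?_
      have hγT : γ ∉ T := fun h => h2 (hother γ h h1)
      rw [← mulVec_mulVec, hfix γ hγ hγT, hyfix γ h1 h2]

theorem mulVec_single_fixed (H : EliminationSystem σ ν c E) {M : Matrix n n K}
    (hM : IsIsometry σ (monomialForm ν c) M)
    (hdiag : ∀ γ, ν γ ≠ γ → ∃ a : K, a ≠ 0 ∧ M *ᵥ Pi.single γ 1 = Pi.single γ a)
    {z : n} (hz : ν z = z) :
    ∃ d : K, d * σ d = 1 ∧ M *ᵥ Pi.single z 1 = Pi.single z d := by
  have hsupp : M *ᵥ Pi.single z 1 = Pi.single z ((M *ᵥ Pi.single z 1) z) := by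
    ext i
    by_cases hi : i = z
    · rw [hi, Pi.single_eq_same]
    · rw [Pi.single_eq_of_ne hi]
      have hνi : ν i ≠ i := fun h => hi (H.fixed_unique i z h hz)
      obtain ⟨a, ha, hMa⟩ := hdiag (ν i) fun h => hνi (H.involutive.injective h)
      have := H.mulVec_single_opposite hM hMa z
      rw [H.involutive, if_neg (Ne.symm hi), mul_eq_zero, map_eq_zero] at this
      exact this.resolve_left ha
  refine ⟨_, ?_, hsupp⟩
  have := H.mulVec_single_opposite hM hsupp z
  rwa [hz, if_pos rfl, mul_comm] at this

end EliminationSystem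

end Elimination

/-! ### The generating shears: action, determinant and invariance of the form. -/

section Generators

variable {n K : Type*} [DecidableEq n] [Field K] {σ : K →+* K} {ν : n → n} {c : n → K}

/-- The matrix `I + t e_{β,α} - σ(t) e_{να,νβ}`, which adds `t` times the coordinate `α` to the
coordinate `β`. -/
def shortShear (σ : K →+* K) (ν : n → n) (β α : n) (t : K) : Matrix n n K :=
  1 + single β α t - single (ν α) (ν β) (σ t)

/-- Each short shear has two descriptions. This is why generators indexed by `i < j` cover both
orders. -/
theorem shortShear_opposite (hν : Function.Involutive ν) (hσ : ∀ x, σ (σ x) = x) (α β : n)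
    (t : K) : shortShear σ ν β α t = shortShear σ ν (ν α) (ν β) (-σ t) := by
  simp only [shortShear, hν α, hν β, map_neg, hσ, ← single_neg]
  abel

variable [Fintype n]

theorem monomialForm_mul_single (hν : Function.Involutive ν) (i j : n) (t : K) :
    monomialForm ν c * single i j t = single (ν i) j (c (ν i) * t) := by
  ext a b
  by_cases hb : b = j
  · subst hb
    rw [mul_single_apply_same]
    by_cases ha : a = ν i
    · simp [ha, monomialForm, hν i]
    · rw [single_apply_of_row_ne (Ne.symm ha)]
      have : i ≠ ν a := fun h => ha (by rw [h, hν])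
      simp [monomialForm, this]
  · rw [mul_single_apply_of_ne _ _ _ _ _ hb, single_apply_of_col_ne _ _ (Ne.symm hb)]

theorem single_mul_monomialForm (i j : n) (t : K) :
    single j i t * monomialForm ν c = single j (ν i) (t * c i) := by
  ext a b
  by_cases ha : a = j
  · subst ha
    rw [single_mul_apply_same]
    by_cases hb : b = ν i
    · simp [hb, monomialForm]
    · simp [hb, monomialForm, single_apply_of_col_ne _ _ (Ne.symm hb)]
  · rw [single_mul_apply_of_ne _ _ _ _ _ ha, single_apply_of_row_ne (Ne.symm ha)]

theorem isIsometry_one_add {β A : Matrix n n K}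
    (h : (A.map σ)ᵀ * β + β * A + (A.map σ)ᵀ * β * A = 0) : IsIsometry σ β (1 + A) := by
  have hmap : (1 + A).map σ = 1 + A.map σ := by
    rw [Matrix.map_add σ (map_add σ), Matrix.map_one σ (map_zero σ) (map_one σ)]
  unfold IsIsometry
  rw [hmap, transpose_add, transpose_one, add_mul, one_mul, mul_add, mul_one, add_mul]
  rw [← sub_eq_zero, ← h]
  abel

theorem isIsometry_long (hν : Function.Involutive ν) {α : n} (hα : ν α ≠ α)
    (hc : ∀ a, ν a ≠ a → c a = 1) {s : K} (hs : σ s = -s) :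
    IsIsometry σ (monomialForm ν c) (1 + single α (ν α) s) := by
  have hνα : ν (ν α) ≠ ν α := fun h => hα (hν.injective h)
  apply isIsometry_one_add
  rw [map_single, transpose_single, single_mul_monomialForm, monomialForm_mul_single hν,
    single_mul_single_of_ne _ _ _ _ hα, hc α hα, hc _ hνα, hs, mul_one, one_mul, ← single_add]
  simp

theorem isIsometry_shortShear (hν : Function.Involutive ν) (hσ : ∀ x, σ (σ x) = x) {α β : n}
    (hα : ν α ≠ α) (hβ : ν β ≠ β) (hαβ : β ≠ α) (hc : ∀ a, ν a ≠ a → c a = 1) (t : K) :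
    IsIsometry σ (monomialForm ν c) (shortShear σ ν β α t) := by
  have hνα : ν (ν α) ≠ ν α := fun h => hα (hν.injective h)
  have hνβ : ν (ν β) ≠ ν β := fun h => hβ (hν.injective h)
  have hναβ : ν β ≠ ν α := fun h => hαβ (hν.injective h)
  rw [shortShear, add_sub_assoc]
  apply isIsometry_one_add
  rw [Matrix.map_sub σ (map_sub σ), transpose_sub, map_single, map_single, transpose_single,
    transpose_single, sub_mul, mul_sub, sub_mul, mul_sub, mul_sub]
  simp only [single_mul_monomialForm, monomialForm_mul_single hν, hν α, hc α hα, hc β hβ,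
    hc _ hνα, hc _ hνβ, mul_one, one_mul, hσ]
  rw [single_mul_single_of_ne _ _ _ _ hβ, single_mul_single_of_ne _ _ _ _ hναβ,
    single_mul_single_of_ne _ _ _ _ hαβ.symm, single_mul_single_of_ne _ _ _ _ hα.symm]
  abel

theorem shortShear_mulVec (α β : n) (t : K) (v : n → K) :
    shortShear σ ν β α t *ᵥ v =
      v + Pi.single β (t * v α) - Pi.single (ν α) (σ t * v (ν β)) := by
  rw [shortShear, sub_mulVec, one_add_single_mulVec, single_mulVec_eq, ← Pi.single_smul,
    smul_eq_mul, mul_one]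

theorem det_one_add_single {α β : n} (h : α ≠ β) (t : K) : (1 + single α β t).det = 1 :=
  det_transvection_of_ne α β h t

theorem det_shortShear {α β : n} (hν : Function.Involutive ν) (hα : ν α ≠ α) (hαβ : β ≠ α)
    (t : K) : (shortShear σ ν β α t).det = 1 := by
  have hναβ : ν α ≠ ν β := fun h => hαβ (hν.injective h).symm
  have hfac : shortShear σ ν β α t =
      (1 + single β α t) * (1 + single (ν α) (ν β) (-σ t)) := by
    simp only [add_mul, mul_add, mul_one, one_mul]
    rw [single_mul_single_of_ne _ _ _ _ hα.symm, shortShear, ← single_neg]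
    abel
  rw [hfac, det_mul, det_one_add_single hαβ, det_one_add_single hναβ, one_mul]

/-- The matrix `I - 2 σ(t) e_{να,z} + t e_{z,α} - t σ(t) e_{να,α}`, which adds `t` times the
coordinate `α` to the coordinate `z`. -/
def fixedShear (σ : K →+* K) (ν : n → n) (z α : n) (t : K) : Matrix n n K :=
  1 - single (ν α) z (2 * σ t) + single z α t - single (ν α) α (t * σ t)

theorem fixedShear_mulVec (z α : n) (t : K) (v : n → K) :
    fixedShear σ ν z α t *ᵥ v =
      v - Pi.single (ν α) (2 * σ t * v z) + Pi.single z (t * v α)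
        - Pi.single (ν α) (t * σ t * v α) := by
  rw [fixedShear, sub_mulVec, add_mulVec, sub_mulVec, one_mulVec, single_mulVec_eq,
    single_mulVec_eq, single_mulVec_eq, ← Pi.single_smul, ← Pi.single_smul, ← Pi.single_smul]
  simp only [smul_eq_mul, mul_one]

theorem det_fixedShear {z α : n} (hα : ν α ≠ α) (hz : ν α ≠ z) (hαz : α ≠ z) (t : K) :
    (fixedShear σ ν z α t).det = 1 := by
  have hfac : fixedShear σ ν z α t =
      (1 + single z α t) * (1 + single (ν α) z (-(2 * σ t))) *
        (1 + single (ν α) α (-(t * σ t))) := by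
    simp only [add_mul, mul_add, mul_one, one_mul]
    rw [single_mul_single_of_ne _ _ _ _ hα.symm, single_mul_single_of_ne _ _ _ _ hα.symm,
      single_mul_single_of_ne _ _ _ _ hz.symm, fixedShear, ← single_neg, ← single_neg]
    simp only [zero_mul]
    abel
  rw [hfac, det_mul, det_mul, det_one_add_single hαz.symm, det_one_add_single hz,
    det_one_add_single hα, one_mul, one_mul]

theorem isIsometry_fixedShear (hν : Function.Involutive ν) (hσ : ∀ x, σ (σ x) = x) {α z : n}
    (hα : ν α ≠ α) (hz : ν z = z) (hc : ∀ a, ν a ≠ a → c a = 1) (hcz : c z = 2) (t : K) :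
    IsIsometry σ (monomialForm ν c) (fixedShear σ ν z α t) := by
  have hνα : ν (ν α) ≠ ν α := fun h => hα (hν.injective h)
  have hzα : z ≠ α := fun h => hα (h ▸ hz)
  have hzνα : z ≠ ν α := fun h => hνα (h ▸ hz)
  have hform : fixedShear σ ν z α t =
      1 + (single z α t - single (ν α) z (2 * σ t) - single (ν α) α (t * σ t)) := by
    rw [fixedShear]
    abel
  rw [hform]
  apply isIsometry_one_add
  rw [Matrix.map_sub σ (map_sub σ), Matrix.map_sub σ (map_sub σ), transpose_sub, transpose_sub]
  simp only [map_single, transpose_single, sub_mul, mul_sub, single_mul_monomialForm,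
    monomialForm_mul_single hν, hν α, hz, hc α hα, hc _ hνα, hcz, mul_one, one_mul, hσ, map_mul,
    map_ofNat, single_mul_single_same, single_mul_single_of_ne _ _ _ _ hzα.symm,
    single_mul_single_of_ne _ _ _ _ hzνα, single_mul_single_of_ne _ _ _ _ hα.symm]
  ext a b
  simp only [Matrix.add_apply, Matrix.sub_apply, Matrix.zero_apply, single_apply]
  split_ifs <;> ring

theorem shortShear_spec {α β : n} (hβν : β ≠ ν α) (t : K) :
    (∀ v, (shortShear σ ν β α t *ᵥ v) β = v β + t * v α) ∧
    (∀ v γ, γ ≠ β → γ ≠ ν α → (shortShear σ ν β α t *ᵥ v) γ = v γ) ∧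
    (∀ γ, γ ≠ α → γ ≠ ν β → shortShear σ ν β α t *ᵥ Pi.single γ 1 = Pi.single γ 1) ∧
    (t = 0 → shortShear σ ν β α t = 1) := by
  refine ⟨fun v => ?_, fun v γ h1 h2 => ?_, fun γ h1 h2 => ?_, fun h => ?_⟩
  · simp [shortShear_mulVec, hβν]
  · simp [shortShear_mulVec, h1, h2]
  · rw [shortShear_mulVec]
    simp [h1.symm, h2.symm]
  · simp [shortShear, h]

theorem fixedShear_spec {α z : n} (hz : z ≠ ν α) (hzν : ν z = z) (t : K) :
    (∀ v, (fixedShear σ ν z α t *ᵥ v) z = v z + t * v α) ∧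
    (∀ v γ, γ ≠ z → γ ≠ ν α → (fixedShear σ ν z α t *ᵥ v) γ = v γ) ∧
    (∀ γ, γ ≠ α → γ ≠ ν z → fixedShear σ ν z α t *ᵥ Pi.single γ 1 = Pi.single γ 1) ∧
    (t = 0 → fixedShear σ ν z α t = 1) := by
  refine ⟨fun v => ?_, fun v γ h1 h2 => ?_, fun γ h1 h2 => ?_, fun h => ?_⟩
  · simp [fixedShear_mulVec, hz]
  · simp [fixedShear_mulVec, h1, h2]
  · rw [hzν] at h2
    rw [fixedShear_mulVec]
    simp [h1.symm, h2.symm]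
  · simp [fixedShear, h]

theorem isIsometry_diagonal {f : n → K} (h : ∀ a, σ (f a) * f (ν a) = 1) :
    IsIsometry σ (monomialForm ν c) (diagonal f) := by
  unfold IsIsometry
  ext a b
  rw [diagonal_map (map_zero σ), diagonal_transpose, mul_diagonal, diagonal_mul]
  by_cases hb : b = ν a
  · simp only [hb, monomialForm, of_apply, if_true]
    linear_combination c a * h a
  · simp [monomialForm, hb]

theorem eq_diagonal_of_mulVec_single {M : Matrix n n K} {f : n → K}
    (h : ∀ γ, M *ᵥ Pi.single γ 1 = Pi.single γ (f γ)) : M = diagonal f := by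
  refine ext_of_mulVec_single fun γ => ?_
  rw [h, diagonal_mulVec_single, mul_one]

end Generators

/-! ### Dimension `2l`. -/

namespace EvenIdx

variable {K : Type*} [Field K] {σ : K →+* K} {l : ℕ}

theorem swap_ne_self (α : EvenIdx l) : α.swap ≠ α := by
  rcases α with i | i <;> simp

theorem evenForm_eq_monomialForm : evenForm K l = monomialForm Sum.swap 1 := by
  ext a b
  rcases a with i | i <;> rcases b with j | j <;>
    simp [evenForm, monomialForm, Matrix.one_apply, eq_comm]

theorem isElementary_shortShear (hσ : ∀ x, σ (σ x) = x) {α β : EvenIdx l} (hβα : β ≠ α)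
    (hβν : β ≠ α.swap) (t : K) : IsElementary σ (shortShear σ Sum.swap β α t) := by
  rcases β with i | i <;> rcases α with j | j
  · exact IsElementary.pos_pos i j (fun h => hβα (h ▸ rfl)) t
  · rcases lt_trichotomy i j with h | h | h
    · exact IsElementary.pos_neg i j h t
    · exact absurd (h ▸ rfl) hβν
    · rw [shortShear_opposite Sum.swap_swap hσ]
      exact IsElementary.pos_neg j i h _
  · rcases lt_trichotomy i j with h | h | h
    · exact IsElementary.neg_pos i j h t
    · exact absurd (h ▸ rfl) hβν
    · rw [shortShear_opposite Sum.swap_swap hσ]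
      exact IsElementary.neg_pos j i h _
  · rw [shortShear_opposite Sum.swap_swap hσ]
    exact IsElementary.pos_pos j i (fun h => hβα (h ▸ rfl)) _

theorem isElementary_long (α : EvenIdx l) {s : K} (hs : σ s = -s) :
    IsElementary σ (1 + single α α.swap s) := by
  rcases α with i | i
  · exact IsElementary.pos_neg_self i s hs
  · exact IsElementary.neg_pos_self i s hs

theorem IsElementary.isometry_and_det (hσ : ∀ x, σ (σ x) = x) {X : Matrix (EvenIdx l) (EvenIdx l) K}
    (hX : IsElementary σ X) : IsIsometry σ (monomialForm Sum.swap 1) X ∧ X.det = 1 := by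
  have hshort : ∀ (α β : EvenIdx l) (t : K), β ≠ α →
      IsIsometry σ (monomialForm Sum.swap 1) (shortShear σ Sum.swap β α t) ∧
        (shortShear σ Sum.swap β α t).det = 1 := fun α β t h =>
    ⟨isIsometry_shortShear Sum.swap_swap hσ (swap_ne_self α) (swap_ne_self β) h
      (fun _ _ => rfl) t, det_shortShear Sum.swap_swap (swap_ne_self α) h t⟩
  have hlong : ∀ (α : EvenIdx l) (s : K), σ s = -s →
      IsIsometry σ (monomialForm Sum.swap 1) (1 + single α α.swap s) ∧
        (1 + single α α.swap s).det = 1 := fun α s hs =>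
    ⟨isIsometry_long Sum.swap_swap (swap_ne_self α) (fun _ _ => rfl) hs,
      det_one_add_single (swap_ne_self α).symm s⟩
  cases hX with
  | pos_pos i j hij t => exact hshort (pos j) (pos i) t (by simpa using hij)
  | pos_neg i j hij t => exact hshort (neg j) (pos i) t (by simp)
  | neg_pos i j hij t => exact hshort (pos j) (neg i) t (by simp)
  | pos_neg_self i s hs => exact hlong (pos i) s hs
  | neg_pos_self i s hs => exact hlong (neg i) s hs

theorem eliminationSystem (hσ : ∀ x, σ (σ x) = x) (hskew : ∃ ε : K, ε ≠ 0 ∧ σ ε = -ε) :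
    EliminationSystem σ (Sum.swap : EvenIdx l → EvenIdx l) 1
      (Submonoid.closure {X | IsElementary σ X}) where
  conj_conj := hσ
  involutive := Sum.swap_swap
  coeff_moved _ _ := rfl
  coeff_ne _ := one_ne_zero
  fixed_unique a _ h _ := absurd h (swap_ne_self a)
  exists_skew := hskew
  isometry g hg := by
    have hle : Submonoid.closure {X : Matrix (EvenIdx l) (EvenIdx l) K | IsElementary σ X} ≤
        isometrySubmonoid σ (monomialForm Sum.swap 1) :=
      Submonoid.closure_le.2 fun X hX => (hX.isometry_and_det hσ).1
    exact hle hg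
  shear α β t _ hβα hβν := ⟨_, Submonoid.subset_closure (isElementary_shortShear hσ hβα hβν t),
    shortShear_spec hβν t⟩
  long α _ _ hs := Submonoid.subset_closure (isElementary_long α hs)

theorem det_eq_one_of_mem_closure (hσ : ∀ x, σ (σ x) = x) {g : Matrix (EvenIdx l) (EvenIdx l) K}
    (hg : g ∈ Submonoid.closure {X | IsElementary σ X}) : g.det = 1 := by
  have hle : Submonoid.closure {X : Matrix (EvenIdx l) (EvenIdx l) K | IsElementary σ X} ≤
      MonoidHom.mker (Matrix.detMonoidHom : Matrix (EvenIdx l) (EvenIdx l) K →* K) :=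
    Submonoid.closure_le.2 fun X hX => (hX.isometry_and_det hσ).2
  exact hle hg

/-- The map sends `v i` to position `-i` with factor `-s⁻¹` and `v (-i)` to position `i` with factor
`s`. Writing it as a correction to `v` makes the other coordinates immediate. -/
theorem w_mulVec (i : Fin l) {s : K} (hs : s ≠ 0) (v : EvenIdx l → K) :
    w i s *ᵥ v = v + Pi.single (pos i) (s * v (neg i) - v (pos i))
      + Pi.single (neg i) (-s⁻¹ * v (pos i) - v (neg i)) := by
  rw [w, xPosNeg, xNegPos, ← mulVec_mulVec, ← mulVec_mulVec, one_add_single_mulVec,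
    one_add_single_mulVec, one_add_single_mulVec]
  ext a
  rcases a with a | a
  · by_cases h : a = i
    · subst h
      simp
      field_simp
      ring
    · simp [h]
  · by_cases h : a = i
    · subst h
      simp
      field_simp
      ring
    · simp [h]

theorem w_mul_w (i : Fin l) {ε a : K} (hε : ε ≠ 0) (ha : a ≠ 0) :
    w i (ε * a) * w i (-ε) = diagAt i a a⁻¹ := by
  refine ext_of_mulVec_single fun γ => ?_
  rw [← mulVec_mulVec]
  generalize (Pi.single γ 1 : EvenIdx l → K) = v
  rw [w_mulVec i (mul_ne_zero hε ha), w_mulVec i (neg_ne_zero.2 hε)]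
  ext b
  rw [diagAt, mulVec_diagonal]
  rcases b with b | b
  · by_cases h : b = i
    · subst h
      simp
      field_simp
    · simp [h]
  · by_cases h : b = i
    · subst h
      simp
      field_simp
    · simp [h]

theorem w_mem_closure (i : Fin l) {s : K} (hs : σ s = -s) :
    w i s ∈ Submonoid.closure {X | IsElementary σ X} := by
  have hs' : σ (-s⁻¹) = -(-s⁻¹) := by rw [map_neg, map_inv₀, hs, inv_neg]
  exact mul_mem (mul_mem (Submonoid.subset_closure (IsElementary.pos_neg_self i s hs))
    (Submonoid.subset_closure (IsElementary.neg_pos_self i _ hs')))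
    (Submonoid.subset_closure (IsElementary.pos_neg_self i s hs))

theorem diagAt_mem_closure (hskew : ∃ ε : K, ε ≠ 0 ∧ σ ε = -ε) (i : Fin l) {a : K} (ha : a ≠ 0)
    (hσa : σ a = a) : diagAt i a a⁻¹ ∈ Submonoid.closure {X | IsElementary σ X} := by
  obtain ⟨ε, hε, hσε⟩ := hskew
  rw [← w_mul_w i hε ha]
  exact mul_mem (w_mem_closure i (by rw [map_mul, hσε, hσa, neg_mul]))
    (w_mem_closure i (by rw [map_neg, hσε]))

theorem det_diagAt (i : Fin l) (a b : K) : (diagAt i a b).det = a * b := by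
  simp [diagAt, Finset.prod_update_of_mem, mul_comm]

theorem isIsometry_diagAt (hσ : ∀ x, σ (σ x) = x) (i : Fin l) {a : K} (ha : a ≠ 0) :
    IsIsometry σ (monomialForm Sum.swap 1) (diagAt i a (σ a)⁻¹) := by
  have hσa : σ a ≠ 0 := by simpa using ha
  refine isIsometry_diagonal fun b => ?_
  rcases b with b | b
  · by_cases h : b = i
    · subst h
      simp [hσa]
    · simp [h]
  · by_cases h : b = i
    · subst h
      simp [hσ, ha]
    · simp [h]

theorem mem_closure_of_isIsometry [Finite K] (hσ : ∀ x, σ (σ x) = x)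
    (hskew : ∃ ε : K, ε ≠ 0 ∧ σ ε = -ε) [NeZero l] {M : Matrix (EvenIdx l) (EvenIdx l) K}
    (hM : IsIsometry σ (monomialForm Sum.swap 1) M) (hdet : M.det = 1) :
    M ∈ Submonoid.closure {X | IsElementary σ X} := by
  have H := eliminationSystem (l := l) hσ hskew
  obtain ⟨g, hg, α, -, a, ha, hgα, hgν, hgfix⟩ := H.exists_reduce Finset.univ M hM
    ⟨pos 0, Finset.mem_univ _⟩ (fun γ _ => swap_ne_self γ) (by simp) (by simp)
  refine mem_submonoid_of_mul_mem hg
    ((H.isometry g hg).isUnit Sum.swap_swap fun _ => one_ne_zero) ?_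
  have hdet' : (g * M).det = 1 := by rw [det_mul, det_eq_one_of_mem_closure hσ hg, hdet, one_mul]
  have hσa0 : σ a ≠ 0 := by simpa using ha
  obtain ⟨i, hi⟩ : ∃ i : Fin l, g * M = diagAt i a (σ a)⁻¹ ∨ g * M = diagAt i (σ a)⁻¹ a := by
    rcases α with i | i
    · refine ⟨i, Or.inl (eq_diagonal_of_mulVec_single fun γ => ?_)⟩
      by_cases h1 : γ = pos i
      · rw [h1, hgα]; simp
      by_cases h2 : γ = neg i
      · rw [h2]; simpa using hgν
      rw [hgfix γ (swap_ne_self γ) h1 h2]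
      rcases γ with j | j
      · have : j ≠ i := fun h => h1 (h ▸ rfl)
        simp [this]
      · have : j ≠ i := fun h => h2 (h ▸ rfl)
        simp [this]
    · refine ⟨i, Or.inr (eq_diagonal_of_mulVec_single fun γ => ?_)⟩
      by_cases h1 : γ = neg i
      · rw [h1, hgα]; simp
      by_cases h2 : γ = pos i
      · rw [h2]; simpa using hgν
      rw [hgfix γ (swap_ne_self γ) h1 h2]
      rcases γ with j | j
      · have : j ≠ i := fun h => h2 (h ▸ rfl)
        simp [this]
      · have : j ≠ i := fun h => h1 (h ▸ rfl)
        simp [this]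
  -- The determinant of the leftover matrix is `a * (σ a)⁻¹`.
  have hσa : σ a = a := by
    have hdiv : a * (σ a)⁻¹ = 1 := by
      rcases hi with h | h <;> rw [h, det_diagAt] at hdet'
      · exact hdet'
      · rwa [mul_comm]
    exact ((mul_inv_eq_one₀ hσa0).1 hdiv).symm
  rw [hσa] at hi
  rcases hi with h | h <;> rw [h]
  · exact diagAt_mem_closure hskew i ha hσa
  · simpa using diagAt_mem_closure hskew i (inv_ne_zero ha) (by rw [map_inv₀, hσa])

theorem diagAt_mem_SU_iff {k : Type*} [Field k] [Fintype k] [Algebra k K]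
    (hK : Module.finrank k K = 2) (i : Fin l) {a : K} (ha : a ≠ 0) :
    diagAt i a (conjFq k K a)⁻¹ ∈ matricesOf (SUEven k K l) ↔
      a ∈ Set.range (algebraMap k K) := by
  have hσa : conjFq k K a ≠ 0 := by simpa using ha
  rw [SUEven, mem_matricesOf_specialUnitaryGp, evenForm_eq_monomialForm, det_diagAt,
    mul_inv_eq_one₀ hσa, ← conjFq_eq_self_iff hK, eq_comm]
  exact and_iff_left (isIsometry_diagAt (conjFq_conjFq hK) i ha)

theorem matricesOf_SUEven {k : Type*} [Field k] [Fintype k] [Algebra k K]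
    (hK : Module.finrank k K = 2) [NeZero l] :
    matricesOf (SUEven k K l) = productsOf {X | IsElementary (conjFq k K) X} := by
  have := finite_of_finrank_eq_two hK
  have hσ := conjFq_conjFq hK
  have hskew := exists_conjFq_eq_neg hK
  ext M
  rw [productsOf_eq_closure, SUEven, mem_matricesOf_specialUnitaryGp, evenForm_eq_monomialForm,
    SetLike.mem_coe]
  exact ⟨fun h => mem_closure_of_isIsometry hσ hskew h.2 h.1, fun h =>
    ⟨det_eq_one_of_mem_closure hσ h, (eliminationSystem hσ hskew).isometry M h⟩⟩

end EvenIdx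

/-! ### Dimension `2l + 1`. -/

namespace OddIdx

variable {K : Type*} [Field K] {σ : K →+* K} {l : ℕ}

/-- The index `-a` opposite to `a`. -/
def opp : OddIdx l → OddIdx l := Sum.map id Sum.swap

/-- The coefficients of the form in dimension `2l + 1`: `2` at the index `0` and `1` elsewhere. -/
def coeff (K : Type*) [Field K] {l : ℕ} : OddIdx l → K := Sum.elim (fun _ => 2) 1

theorem opp_involutive : Function.Involutive (opp : OddIdx l → OddIdx l) := by
  rintro (z | i | i) <;> rfl

theorem opp_ne_self (α : EvenIdx l) : opp (Sum.inr α : OddIdx l) ≠ Sum.inr α := by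
  rcases α with i | i <;> simp [opp]

theorem exists_eq_inr {α : OddIdx l} (h : opp α ≠ α) : ∃ β : EvenIdx l, α = Sum.inr β := by
  rcases α with z | β
  · exact absurd rfl h
  · exact ⟨β, rfl⟩

theorem coeff_of_opp_ne (α : OddIdx l) (h : opp α ≠ α) : coeff K α = 1 := by
  obtain ⟨β, rfl⟩ := exists_eq_inr h
  rfl

theorem oddForm_eq_monomialForm : oddForm K l = monomialForm opp (coeff K) := by
  ext a b
  rcases a with z | a <;> rcases b with z' | b
  · simp [oddForm, monomialForm, opp, coeff]
  · simp [oddForm, monomialForm, opp]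
  · simp [oddForm, monomialForm, opp]
  · simp [oddForm, monomialForm, opp, coeff, EvenIdx.evenForm_eq_monomialForm]

theorem isElementary_shortShear (hσ : ∀ x, σ (σ x) = x) {α β : EvenIdx l} (hβα : β ≠ α)
    (hβν : β ≠ α.swap) (t : K) :
    IsElementary σ (shortShear σ opp (Sum.inr β) (Sum.inr α) t) := by
  rcases β with i | i <;> rcases α with j | j
  · exact IsElementary.pos_pos i j (fun h => hβα (h ▸ rfl)) t
  · rcases lt_trichotomy i j with h | h | h
    · exact IsElementary.pos_neg i j h t
    · exact absurd (h ▸ rfl) hβν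
    · rw [shortShear_opposite opp_involutive hσ]
      exact IsElementary.pos_neg j i h _
  · rcases lt_trichotomy i j with h | h | h
    · exact IsElementary.neg_pos i j h t
    · exact absurd (h ▸ rfl) hβν
    · rw [shortShear_opposite opp_involutive hσ]
      exact IsElementary.neg_pos j i h _
  · rw [shortShear_opposite opp_involutive hσ]
    exact IsElementary.pos_pos j i (fun h => hβα (h ▸ rfl)) _

theorem isElementary_long (α : EvenIdx l) {s : K} (hs : σ s = -s) :
    IsElementary σ (1 + single (Sum.inr α) (opp (Sum.inr α)) s : Matrix (OddIdx l) _ K) := by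
  rcases α with i | i
  · exact IsElementary.pos_neg_self i s hs
  · exact IsElementary.neg_pos_self i s hs

theorem fixedShear_pos (i : Fin l) (t : K) : fixedShear σ opp zero (pos i) t =
    1 + single zero (pos i) t - single (neg i) zero (2 * σ t)
      - single (neg i) (pos i) (t * σ t) := by
  simp only [fixedShear, opp, Sum.map_inr, Sum.swap_inl]
  abel

theorem isElementary_fixedShear (α : EvenIdx l) (t : K) :
    IsElementary σ (fixedShear σ opp zero (Sum.inr α) t) := by
  rcases α with i | i
  · rw [fixedShear_pos]
    exact IsElementary.zero_pos i t
  · exact IsElementary.pos_zero i t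

theorem IsElementary.isometry_and_det (hσ : ∀ x, σ (σ x) = x) {X : Matrix (OddIdx l) (OddIdx l) K}
    (hX : IsElementary σ X) : IsIsometry σ (monomialForm opp (coeff K)) X ∧ X.det = 1 := by
  have hshort : ∀ (α β : EvenIdx l) (t : K), β ≠ α →
      IsIsometry σ (monomialForm opp (coeff K)) (shortShear σ opp (Sum.inr β) (Sum.inr α) t) ∧
        (shortShear σ opp (Sum.inr β : OddIdx l) (Sum.inr α) t).det = 1 := fun α β t h =>
    ⟨isIsometry_shortShear opp_involutive hσ (opp_ne_self α) (opp_ne_self β)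
      (Sum.inr_injective.ne h) coeff_of_opp_ne t,
      det_shortShear opp_involutive (opp_ne_self α) (Sum.inr_injective.ne h) t⟩
  have hlong : ∀ (α : EvenIdx l) (s : K), σ s = -s →
      IsIsometry σ (monomialForm opp (coeff K)) (1 + single (Sum.inr α) (opp (Sum.inr α)) s) ∧
        (1 + single (Sum.inr α : OddIdx l) (opp (Sum.inr α)) s).det = 1 := fun α s hs =>
    ⟨isIsometry_long opp_involutive (opp_ne_self α) coeff_of_opp_ne hs,
      det_one_add_single (opp_ne_self α).symm s⟩
  have hfixed : ∀ (α : EvenIdx l) (t : K),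
      IsIsometry σ (monomialForm opp (coeff K)) (fixedShear σ opp zero (Sum.inr α) t) ∧
        (fixedShear σ opp zero (Sum.inr α : OddIdx l) t).det = 1 := fun α t =>
    ⟨isIsometry_fixedShear opp_involutive hσ (opp_ne_self α) rfl coeff_of_opp_ne rfl t,
      det_fixedShear (opp_ne_self α) Sum.inr_ne_inl Sum.inr_ne_inl t⟩
  cases hX with
  | pos_pos i j hij t => exact hshort (Sum.inl j) (Sum.inl i) t (by simpa using hij)
  | pos_neg i j hij t => exact hshort (Sum.inr j) (Sum.inl i) t (by simp)
  | neg_pos i j hij t => exact hshort (Sum.inl j) (Sum.inr i) t (by simp)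
  | pos_neg_self i s hs => exact hlong (Sum.inl i) s hs
  | neg_pos_self i s hs => exact hlong (Sum.inr i) s hs
  | pos_zero i t => exact hfixed (Sum.inr i) t
  | zero_pos i t => exact fixedShear_pos (σ := σ) i t ▸ hfixed (Sum.inl i) t

theorem isIsometry_h {z : K} (hz : z * σ z = 1) :
    IsIsometry σ (monomialForm opp (coeff K)) (h l z) := by
  refine isIsometry_diagonal ?_
  rintro (a | a | a)
  · simpa [opp, mul_comm] using hz
  · simp [opp]
  · simp [opp]

theorem h_pow (z : K) (m : ℕ) : h l (z ^ m) = h l z ^ m := by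
  rw [h, h, diagonal_pow]
  congr 1
  ext (a | a) <;> simp

theorem isIsometry_of_mem_closure (hσ : ∀ x, σ (σ x) = x) {ζ : K} (hζ : ζ * σ ζ = 1)
    {g : Matrix (OddIdx l) (OddIdx l) K}
    (hg : g ∈ Submonoid.closure ({X | IsElementary σ X} ∪ {h l ζ})) :
    IsIsometry σ (monomialForm opp (coeff K)) g := by
  have hle : Submonoid.closure ({X | IsElementary σ X} ∪ {h l ζ}) ≤
      isometrySubmonoid σ (monomialForm opp (coeff K)) := by
    refine Submonoid.closure_le.2 (Set.union_subset ?_ (Set.singleton_subset_iff.2 ?_))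
    · exact fun X hX => (IsElementary.isometry_and_det hσ hX).1
    · exact isIsometry_h hζ
  exact hle hg

theorem eliminationSystem (h2 : (2 : K) ≠ 0) (hσ : ∀ x, σ (σ x) = x)
    (hskew : ∃ ε : K, ε ≠ 0 ∧ σ ε = -ε) {ζ : K} (hζ : ζ * σ ζ = 1) :
    EliminationSystem σ (opp : OddIdx l → OddIdx l) (coeff K)
      (Submonoid.closure ({X | IsElementary σ X} ∪ {h l ζ})) where
  conj_conj := hσ
  involutive := opp_involutive
  coeff_moved := coeff_of_opp_ne
  coeff_ne a := by
    rcases a with z | a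
    · exact h2
    · exact one_ne_zero
  fixed_unique a b ha hb := by
    rcases a with z | a
    · rcases b with z' | b
      · rfl
      · exact absurd hb (opp_ne_self b)
    · exact absurd ha (opp_ne_self a)
  exists_skew := hskew
  isometry g hg := isIsometry_of_mem_closure hσ hζ hg
  shear α β t hα hβα hβν := by
    obtain ⟨α, rfl⟩ := exists_eq_inr hα
    rcases β with ⟨⟩ | β
    · exact ⟨_, Submonoid.subset_closure (Or.inl (isElementary_fixedShear α t)),
        fixedShear_spec hβν rfl t⟩
    · exact ⟨_, Submonoid.subset_closure (Or.inl (isElementary_shortShear hσ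
        (fun h => hβα (congrArg Sum.inr h)) (fun h => hβν (congrArg Sum.inr h)) t)),
        shortShear_spec hβν t⟩
  long α s hα hs := by
    obtain ⟨α, rfl⟩ := exists_eq_inr hα
    exact Submonoid.subset_closure (Or.inl (isElementary_long α hs))

/-- In the odd-dimensional case the shears along the index `0` rescale a coordinate vector
arbitrarily, up to other coordinates. -/
theorem exists_rescale (h2 : (2 : K) ≠ 0) (hσ : ∀ x, σ (σ x) = x)
    (hnorm : ∀ r : K, σ r = r → ∃ m : K, m * σ m = r) (α : EvenIdx l) {a : K} (ha : a ≠ 0) :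
    ∃ y ∈ Submonoid.closure {X | IsElementary σ X},
      (y *ᵥ Pi.single (Sum.inr α) a) (Sum.inr α : OddIdx l) = 1 ∧
      ∀ γ : EvenIdx l, γ ≠ α → γ ≠ α.swap →
        y *ᵥ Pi.single (Sum.inr γ) 1 = Pi.single (Sum.inr γ : OddIdx l) 1 := by
  -- The norm of `m` is chosen as the fixed part of `a⁻¹`, so that `m * σ m - a⁻¹` is skew; `σ m -
  -- m` is always skew.
  obtain ⟨m, hm⟩ := hnorm ((a⁻¹ + σ a⁻¹) / 2) (by
    rw [map_div₀, map_add, hσ, map_ofNat, add_comm])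
  have hm' : 2 * (m * σ m) = a⁻¹ + σ a⁻¹ := by
    rw [hm]
    field_simp
  have hs : σ (σ m - m + m * σ m - a⁻¹) = -(σ m - m + m * σ m - a⁻¹) := by
    rw [map_sub, map_add, map_sub, map_mul, hσ]
    linear_combination hm'
  have hαs := EvenIdx.swap_ne_self α
  -- The right-hand shear produces `a` at `0` and `-a` at `-α`. The middle one then turns the entry
  -- at `α` into `a * (σ m - m + m * σ m)`, and the long transvection subtracts what exceeds `1`.
  refine ⟨_, mul_mem (Submonoid.subset_closure (isElementary_long α hs))
    (mul_mem (Submonoid.subset_closure (isElementary_fixedShear α.swap (1 - m)))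
      (Submonoid.subset_closure (isElementary_fixedShear α 1))), ?_, fun γ h1 h2 => ?_⟩
  · rw [← mulVec_mulVec, ← mulVec_mulVec, fixedShear_mulVec, fixedShear_mulVec,
      one_add_single_mulVec]
    simp [opp, hαs, hαs.symm]
    field_simp
    ring
  · rw [← mulVec_mulVec, ← mulVec_mulVec, fixedShear_mulVec, fixedShear_mulVec,
      one_add_single_mulVec]
    simp [opp, h1.symm, h2.symm]

/-- No determinant condition is needed: the elementary matrices and `h l ζ` generate all isometries,
and determinant one is imposed only afterwards. -/
theorem mem_closure_of_isIsometry [Finite K] (h2 : (2 : K) ≠ 0) (hσ : ∀ x, σ (σ x) = x)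
    (hskew : ∃ ε : K, ε ≠ 0 ∧ σ ε = -ε) (hnorm : ∀ r : K, σ r = r → ∃ m : K, m * σ m = r)
    [NeZero l] {ζ : K} (hζ : ζ * σ ζ = 1) (hgen : ∀ d : K, d * σ d = 1 → ∃ m : ℕ, ζ ^ m = d)
    {M : Matrix (OddIdx l) (OddIdx l) K} (hM : IsIsometry σ (monomialForm opp (coeff K)) M) :
    M ∈ Submonoid.closure ({X | IsElementary σ X} ∪ {h l ζ}) := by
  have H := eliminationSystem (l := l) h2 hσ hskew hζ
  obtain ⟨g, hg, α, hα, a, ha, hgα, -, hgfix⟩ := H.exists_reduce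
    (Finset.univ.filter fun γ => opp γ ≠ γ) M hM
    ⟨pos 0, Finset.mem_filter.2 ⟨Finset.mem_univ _, opp_ne_self _⟩⟩ (fun γ hγ => by simpa using hγ)
    (fun γ hγ => by
      simp only [Finset.mem_filter, Finset.mem_univ, true_and] at hγ ⊢
      exact fun h => hγ (opp_involutive.injective h))
    (fun γ h1 h2 => (h2 (by simpa using h1)).elim)
  obtain ⟨α, rfl⟩ := exists_eq_inr hα
  obtain ⟨y, hy, hyα, hyfix⟩ := exists_rescale h2 hσ hnorm α ha
  replace hy := Submonoid.closure_mono Set.subset_union_left hy (t := _ ∪ {h l ζ})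
  rw [← hgα, mulVec_mulVec, ← mul_assoc] at hyα
  have hyg := mul_mem hy hg
  -- Rescaling spoils other entries of the column, so the pair is cleared again, now with pivot `1`.
  obtain ⟨g', hg', hα', hν', hfix'⟩ := H.exists_normalize_pair ((H.isometry _ hyg).mul hM) hα
    hyα one_ne_zero
  rw [map_one, inv_one] at hν'
  rw [← mul_assoc] at hα' hν' hfix'
  have hgg := mul_mem hg' hyg
  have hfix : ∀ γ : EvenIdx l, (g' * (y * g) * M) *ᵥ Pi.single (Sum.inr γ) 1 =
      Pi.single (Sum.inr γ) 1 := by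
    intro γ
    by_cases h1 : γ = α
    · rw [h1, hα']
    by_cases h2 : γ = α.swap
    · rw [h2]; exact hν'
    have h1' : (Sum.inr γ : OddIdx l) ≠ Sum.inr α := Sum.inr_injective.ne h1
    have h2' : (Sum.inr γ : OddIdx l) ≠ opp (Sum.inr α) := Sum.inr_injective.ne h2
    refine hfix' _ h1' h2' ?_
    rw [mul_assoc, ← mulVec_mulVec, hgfix _ (opp_ne_self γ) h1' h2', hyfix γ h1 h2]
  obtain ⟨d, hd, hzero⟩ := H.mulVec_single_fixed ((H.isometry _ hgg).mul hM)
    (fun γ hγ => by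
      obtain ⟨γ, rfl⟩ := exists_eq_inr hγ
      exact ⟨1, one_ne_zero, hfix γ⟩) (z := zero) rfl
  have hdiag : g' * (y * g) * M = h l d := by
    refine eq_diagonal_of_mulVec_single ?_
    rintro (⟨⟩ | γ)
    · exact hzero
    · exact hfix γ
  refine mem_submonoid_of_mul_mem hgg
    ((H.isometry _ hgg).isUnit opp_involutive H.coeff_ne) ?_
  obtain ⟨m, rfl⟩ := hgen d hd
  rw [hdiag, h_pow]
  exact Submonoid.pow_mem _
    (Submonoid.subset_closure (Set.mem_union_right _ (Set.mem_singleton _))) m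

theorem isElementary_subset_SUOdd {k : Type*} [Field k] [Fintype k] [Algebra k K]
    (hK : Module.finrank k K = 2) :
    {X | IsElementary (conjFq k K) X} ⊆ matricesOf (SUOdd k K l) := by
  intro X hX
  rw [SUOdd, mem_matricesOf_specialUnitaryGp, oddForm_eq_monomialForm]
  exact (IsElementary.isometry_and_det (conjFq_conjFq hK) hX).symm

theorem h_mem_unitaryGp {ζ : K} (hζ : ζ * σ ζ = 1) :
    h l ζ ∈ matricesOf (unitaryGp σ (oddForm K l)) := by
  rw [mem_matricesOf_unitaryGp, oddForm_eq_monomialForm]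
  refine ⟨?_, isIsometry_h hζ⟩
  have hdet : (h l ζ).det = ζ := by simp [h]
  rw [hdet, isUnit_iff_ne_zero]
  exact left_ne_zero_of_mul_eq_one hζ

theorem matricesOf_SUOdd {k : Type*} [Field k] [Fintype k] [Algebra k K]
    (hK : Module.finrank k K = 2) [NeZero l] (h2 : (2 : K) ≠ 0) {ζ : K}
    (hζ : ζ * conjFq k K ζ = 1) (hgen : ∀ d : K, d * conjFq k K d = 1 → ∃ m : ℕ, ζ ^ m = d) :
    matricesOf (SUOdd k K l) =
      {M | M ∈ productsOf ({X | IsElementary (conjFq k K) X} ∪ {h l ζ}) ∧ M.det = 1} := by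
  have := finite_of_finrank_eq_two hK
  have hσ := conjFq_conjFq hK
  ext M
  rw [productsOf_eq_closure, SUOdd, mem_matricesOf_specialUnitaryGp, oddForm_eq_monomialForm,
    Set.mem_ofPred_eq, SetLike.mem_coe, and_comm]
  exact and_congr_left fun _ => ⟨mem_closure_of_isIsometry h2 hσ (exists_conjFq_eq_neg hK)
    (fun _ => exists_mul_conjFq_eq hK) hζ hgen, isIsometry_of_mem_closure hσ hζ⟩

end OddIdx

/-! ### The main theorem. -/

theorem mainTheorem3 {k K : Type*} [Field k] [Fintype k] [Field K] [Algebra k K]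
    (hK : Module.finrank k K = 2) (l : ℕ) (hl : 2 ≤ l) :
    -- even order: the products of elementary matrices are exactly the elements of `SU(2l, q²)`
    (matricesOf (SUEven k K l) = productsOf {X | EvenIdx.IsElementary (conjFq k K) X}) ∧
    -- a leftover diagonal matrix lies in `SU(2l, q²)` exactly when its entry lies in `F_q`
    (∀ c : K, c ≠ 0 →
      (EvenIdx.diagAt (lastIdx l hl) c (conjFq k K c)⁻¹ ∈ matricesOf (SUEven k K l) ↔
        c ∈ Set.range (algebraMap k K))) ∧
    -- and it is then the product of two row-interchange matrices, hence of elementary matrices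
    (∀ ε : K, ε ≠ 0 → conjFq k K ε = -ε → ∀ c : k, c ≠ 0 →
      EvenIdx.w (lastIdx l hl) (ε * algebraMap k K c) * EvenIdx.w (lastIdx l hl) (-ε) =
        EvenIdx.diagAt (lastIdx l hl) (algebraMap k K c) (algebraMap k K c)⁻¹ ∧
      EvenIdx.w (lastIdx l hl) (ε * algebraMap k K c) ∈
        productsOf {X | EvenIdx.IsElementary (conjFq k K) X} ∧
      EvenIdx.w (lastIdx l hl) (-ε) ∈
        productsOf {X | EvenIdx.IsElementary (conjFq k K) X}) ∧
    -- odd order, odd characteristic: the elements of `SU(2l + 1, q²)` are exactly the products of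
    -- determinant one of elementary matrices and copies of `h(ζ₁)`, where `ζ₁` generates the
    -- group of elements of norm one
    ((2 : K) ≠ 0 → ∀ ζ₁ : Kˣ,
      (∀ x : Kˣ, x ∈ Subgroup.zpowers ζ₁ ↔ (x : K) * conjFq k K (x : K) = 1) →
      {X | OddIdx.IsElementary (conjFq k K) X} ⊆ matricesOf (SUOdd k K l) ∧
      OddIdx.h l (ζ₁ : K) ∈ matricesOf (unitaryGp (conjFq k K) (oddForm K l)) ∧
      matricesOf (SUOdd k K l) =
        {M | M ∈ productsOf ({X | OddIdx.IsElementary (conjFq k K) X} ∪ {OddIdx.h l (ζ₁ : K)}) ∧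
          M.det = 1}) := by
  have : NeZero l := ⟨by omega⟩
  have := finite_of_finrank_eq_two hK
  refine ⟨EvenIdx.matricesOf_SUEven hK, fun c hc => EvenIdx.diagAt_mem_SU_iff hK _ hc,
    fun ε hε hσε c hc => ?_, fun h2 ζ hζ => ?_⟩
  · rw [productsOf_eq_closure]
    exact ⟨EvenIdx.w_mul_w _ hε (by simpa using hc),
      EvenIdx.w_mem_closure _ (by rw [map_mul, hσε, conjFq_algebraMap, neg_mul]),
      EvenIdx.w_mem_closure _ (by rw [map_neg, hσε])⟩
  · have hnorm := (hζ ζ).1 (Subgroup.mem_zpowers ζ)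
    refine ⟨OddIdx.isElementary_subset_SUOdd hK, OddIdx.h_mem_unitaryGp hnorm,
      OddIdx.matricesOf_SUOdd hK h2 hnorm fun d hd => ?_⟩
    have hmem := (hζ (Units.mk0 d (left_ne_zero_of_mul_eq_one hd))).2 hd
    -- In a finite group integer powers are natural powers, so copies of `h ζ₁` suffice without its
    -- inverse.
    obtain ⟨m, hm⟩ := mem_powers_iff_mem_zpowers.2 hmem
    exact ⟨m, by simpa using congrArg Units.val hm⟩
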